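/- For each $n\ge 1$ let $\mathcal H_n^A,\mathcal H_n^B$ be finite-dimensional complex Hilbert spaces and let $|\psi_n\rangle\in\mathcal H_n^A\otimes\mathcal H_n^B$ be a unit vector; write $\psi_n^{AB}=|\psi_n\rangle\langle\psi_n|$, $\psi_n^A=\mathrm{Tr}_B\,\psi_n^{AB}$, $\widehat\psi^{AB}=\{\psi_n^{AB}\}_n$ and $\widehat\psi^A=\{\psi_n^A\}_n$. No further assumption is made on the sequence. A real number $R$ is called achievable if there are positive integers $M_n$ and, for each $n$, a maximally entangled state $|\Phi_{M_n}\rangle\in\mathcal H_n^A\otimes\mathcal H_n^B$ of Schmidt rank $M_n$ (that is, $|\Phi_{M_n}\rangle=M_n^{-1/2}\sum_{k=1}^{M_n}|e_k\rangle\otimes|f_k\rangle$ with orthonormal families $(e_k)$ in $\mathcal H_n^A$ and $(f_k)$ in $\mathcal H_n^B$), and maps $\mathcal L_n$ on $\mathcal H_n^A\otimes\mathcal H_n^B$ implemented by finite-round LOCC protocols (local operations and classical communication), such that $$\lim_{n\to\infty}\bigl\|\mathcal L_n(\psi_n^{AB})-|\Phi_{M_n}\rangle\langle\Phi_{M_n}|\bigr\|_1=0\qquad\text{and}\qquad\liminf_{n\to\infty}\frac1n\log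 M_n\ge R,$$ where $\|X\|_1=\mathrm{Tr}|X|$ and $\log$ is the natural logarithm. The entanglement concentration rate (distillable entanglement) is $R(\widehat\psi^{AB})=\sup\{R\in\mathbb R: R\text{ is achievable}\}\in[-\infty,\infty]$. For a sequence $\widehat\rho=\{\rho_n\}$ of density operators on finite-dimensional Hilbert spaces, the inf-spectral entropy rate is $\underline H(\widehat\rho)=-\overline D(0|\widehat\rho\|\widehat I)$, where $$\overline D(0|\widehat\rho\|\widehat I)=\inf\Bigl\{a\in\mathbb R:\ \limsup_{n\to\infty}\mathrm{Tr}\,\rho_n\{\rho_n-e^{na}I_n>0\}\le 0\Bigr\}\in[-\infty,\infty],$$ $I_n$ is the identity operator and $\{A>0\}$ is the spectral projection of a Hermitian operator $A$ onto the sum of its eigenspaces with positive eigenvalues. Then, for every such sequence of bipartite pure states, $$R(\widehat\psi^{AB})=\underline H(\widehat\psi^A).$$ -/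

import Mathlib

open Filter Topology
open scoped Matrix Kronecker

noncomputable section

namespace EntConc

/-! ### Operators on finite-dimensional Hilbert spaces, written as complex matrices -/

/-- The trace norm `‖A‖₁ = Tr |A|`, where `|A| = √(A† A)` by functional calculus. -/
def traceNorm {ι : Type*} [Fintype ι] [DecidableEq ι] (A : Matrix ι ι ℂ) : ℝ :=
  (cfc Real.sqrt (Aᴴ * A)).trace.re

/-- The spectral projection `{A > 0}` of a Hermitian matrix `A` onto the sum of its eigenspaces
with positive eigenvalues. -/
def posProj {ι : Type*} [Fintype ι] [DecidableEq ι] (A : Matrix ι ι ℂ) : Matrix ι ι ℂ :=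
  cfc (Set.indicator (Set.Ioi (0 : ℝ)) (fun _ => (1 : ℝ))) A

/-- The density operator `|ψ⟩⟨ψ|` of a vector `ψ`. -/
def pureDensity {ι : Type*} (ψ : EuclideanSpace ℂ ι) : Matrix ι ι ℂ :=
  Matrix.of fun i j => ψ i * star (ψ j)

/-- The partial trace over the second tensor factor. -/
def partialTraceB {ι κ : Type*} [Fintype κ] (ρ : Matrix (ι × κ) (ι × κ) ℂ) : Matrix ι ι ℂ :=
  Matrix.of fun i i' => ∑ j, ρ (i, j) (i', j)

/-! ### Spectral divergence and entropy rates -/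

/-- The spectral sup-divergence rate
`inf {a ∈ ℝ | limsup_n Tr ρ_n {ρ_n - e^{na} σ_n > 0} ≤ ε}`, with values in `[-∞, ∞]`. -/
def supSpectralDivergenceRate (ε : ℝ) {d : ℕ → ℕ}
    (ρ σ : ∀ n, Matrix (Fin (d n)) (Fin (d n)) ℂ) : EReal :=
  sInf ((fun a : ℝ => (a : EReal)) ''
    {a : ℝ | limsup (fun n : ℕ =>
      (((ρ n * posProj (ρ n - Real.exp (n * a) • σ n)).trace.re : ℝ) : EReal)) atTop
        ≤ (ε : EReal)})

/-- The spectral inf-entropy rate at level `ε`: minus the spectral sup-divergence rate relative to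
the sequence of identity operators. -/
def infSpectralEntropyRateAt (ε : ℝ) {d : ℕ → ℕ}
    (ρ : ∀ n, Matrix (Fin (d n)) (Fin (d n)) ℂ) : EReal :=
  - supSpectralDivergenceRate ε ρ (fun _ => 1)

/-- The spectral inf-entropy rate (level `ε = 0`). -/
def infSpectralEntropyRate {d : ℕ → ℕ}
    (ρ : ∀ n, Matrix (Fin (d n)) (Fin (d n)) ℂ) : EReal :=
  infSpectralEntropyRateAt 0 ρ

/-! ### Local operations and classical communication -/

/-- `IsLOCC a' b' a b L` says that `L` is the overall map, from operators on `ℂ^a ⊗ ℂ^b` to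
operators on `ℂ^a' ⊗ ℂ^b'`, of a protocol with finitely many rounds. Either nothing is left to do,
or one of the two parties performs a measurement on their own system with finitely many outcomes
`k` and Kraus operators `K k` (`∑ k, (K k)† (K k) = 1`), announces the outcome `k`, and the parties
go on with a protocol that may depend on `k`. The output system of `K k` may have any finite
dimension, so that local isometries, adding local ancillas, discarding local subsystems and
forgetting outcomes (by ignoring `k` in what follows) are all included. -/
inductive IsLOCC (a' b' : ℕ) : ∀ a b : ℕ,
    (Matrix (Fin a × Fin b) (Fin a × Fin b) ℂ → Matrix (Fin a' × Fin b') (Fin a' × Fin b') ℂ) →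
    Prop
  | done : IsLOCC a' b' a' b' (fun X => X)
  | alice {a b m : ℕ} (c : Fin m → ℕ) (K : ∀ k, Matrix (Fin (c k)) (Fin a) ℂ)
      (hK : ∑ k, (K k)ᴴ * K k = 1)
      (L : ∀ k, Matrix (Fin (c k) × Fin b) (Fin (c k) × Fin b) ℂ →
        Matrix (Fin a' × Fin b') (Fin a' × Fin b') ℂ)
      (hL : ∀ k, IsLOCC a' b' (c k) b (L k)) :
      IsLOCC a' b' a b (fun X => ∑ k,
        L k ((K k ⊗ₖ (1 : Matrix (Fin b) (Fin b) ℂ)) * X *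
          (K k ⊗ₖ (1 : Matrix (Fin b) (Fin b) ℂ))ᴴ))
  | bob {a b m : ℕ} (c : Fin m → ℕ) (K : ∀ k, Matrix (Fin (c k)) (Fin b) ℂ)
      (hK : ∑ k, (K k)ᴴ * K k = 1)
      (L : ∀ k, Matrix (Fin a × Fin (c k)) (Fin a × Fin (c k)) ℂ →
        Matrix (Fin a' × Fin b') (Fin a' × Fin b') ℂ)
      (hL : ∀ k, IsLOCC a' b' a (c k) (L k)) :
      IsLOCC a' b' a b (fun X => ∑ k,
        L k (((1 : Matrix (Fin a) (Fin a) ℂ) ⊗ₖ K k) * X *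
          ((1 : Matrix (Fin a) (Fin a) ℂ) ⊗ₖ K k)ᴴ))

/-- The sequence of pure states `ψ` can be asymptotically converted into `φ` by LOCC:
`‖L_n(ψ_n) - φ_n‖₁ → 0` for some sequence of LOCC maps `L_n`. -/
def AsympConvertible {dA dB : ℕ → ℕ}
    (ψ φ : ∀ n, EuclideanSpace ℂ (Fin (dA n) × Fin (dB n))) : Prop :=
  ∃ L : ∀ n, Matrix (Fin (dA n) × Fin (dB n)) (Fin (dA n) × Fin (dB n)) ℂ →
      Matrix (Fin (dA n) × Fin (dB n)) (Fin (dA n) × Fin (dB n)) ℂ,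
    (∀ n, IsLOCC (dA n) (dB n) (dA n) (dB n) (L n)) ∧
    Tendsto (fun n => traceNorm (L n (pureDensity (ψ n)) - pureDensity (φ n))) atTop (𝓝 0)

/-! ### Entanglement concentration -/

/-- `Φ` is a maximally entangled state of Schmidt rank `M ≥ 1`: for some orthonormal families
`e_1, …, e_M` and `f_1, …, f_M` one has `Φ = M^{-1/2} ∑ k, e_k ⊗ f_k`. -/
def IsMaxEntangled {a b : ℕ} (M : ℕ) (Φ : EuclideanSpace ℂ (Fin a × Fin b)) : Prop :=
  0 < M ∧
  ∃ (e : Fin M → EuclideanSpace ℂ (Fin a)) (f : Fin M → EuclideanSpace ℂ (Fin b)),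
    Orthonormal ℂ e ∧ Orthonormal ℂ f ∧
    ∀ i j, Φ (i, j) = (((√(M : ℝ))⁻¹ : ℝ) : ℂ) * ∑ k, e k i * f k j

/-- The rate `R` is achievable for concentrating the entanglement of the sequence `ψ`. -/
def Achievable {dA dB : ℕ → ℕ}
    (ψ : ∀ n, EuclideanSpace ℂ (Fin (dA n) × Fin (dB n))) (R : ℝ) : Prop :=
  ∃ (M : ℕ → ℕ) (Φ : ∀ n, EuclideanSpace ℂ (Fin (dA n) × Fin (dB n))),
    (∀ n, IsMaxEntangled (M n) (Φ n)) ∧ AsympConvertible ψ Φ ∧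
    (R : EReal) ≤ liminf (fun n : ℕ => ((1 / (n : ℝ) * Real.log (M n) : ℝ) : EReal)) atTop

/-- The entanglement concentration rate (distillable entanglement), with values in `[-∞, ∞]`. -/
def concentrationRate {dA dB : ℕ → ℕ}
    (ψ : ∀ n, EuclideanSpace ℂ (Fin (dA n) × Fin (dB n))) : EReal :=
  sSup ((fun R : ℝ => (R : EReal)) '' {R : ℝ | Achievable ψ R})

end EntConc

end

namespace EntConc

open Matrix hiding sub_apply
open scoped ComplexOrder

/-! ### Functional calculus and the trace norm of Hermitian matrices -/

section TraceNorm

variable {ι : Type*} [Fintype ι] [DecidableEq ι]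

/-! Both inequalities reduce to one-shot estimates in terms of the weight `δ` that the eigenvalues
of `ψ^A` above a cutoff `c` carry; afterwards `c = e^{na}`.

Converse (`IsLOCC.trace_mul_posProj_le`). An LOCC map has product Kraus operators `A_k ⊗ B_k`, which
cannot raise Schmidt rank. Split `ψ` into the part with Schmidt weights above `c` and the rest. The
first part has at most `1/c` Schmidt terms, so by `normSq_overlap_le` its images overlap with `Φ_M`
by at most `1/(cM)`. The rest has squared norm `1 - δ` and can contribute no more than that. Hence
the fidelity is at most about `1 - δ`, and a small error forces a small `δ` once `cM` is large.

Direct part (`exists_isLOCC_concentration`). Discard the weights above `c`. What remains has total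
weight `s = 1 - δ` and entries at most `c`, so when rescaled to total `M ≈ s/c` it lies in the cube
`[0,1]^ι`. By `exists_hypersimplex_weights` it is then a mixture of indicators of `M`-element sets.
Alice's measurement realises this mixture: each successful outcome leaves a maximally entangled
state on the chosen `M` Schmidt vectors, and Bob rotates it to a fixed target. -/

theorem exists_unitary_cfc {H : Matrix ι ι ℂ} (hH : H.IsHermitian) :
    ∃ U : Matrix ι ι ℂ, Uᴴ * U = 1 ∧ U * Uᴴ = 1 ∧
      H = U * diagonal (fun i => (hH.eigenvalues i : ℂ)) * Uᴴ ∧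
      ∀ f : ℝ → ℝ, cfc f H = U * diagonal (fun i => (f (hH.eigenvalues i) : ℂ)) * Uᴴ := by
  refine ⟨hH.eigenvectorUnitary, ?_, ?_, ?_, fun f => ?_⟩
  · exact Unitary.coe_star_mul_self _
  · exact Unitary.coe_mul_star_self _
  · conv_lhs => rw [hH.spectral_theorem]
    rfl
  · rw [hH.cfc_eq]
    rfl

theorem traceNorm_eq_sum {H : Matrix ι ι ℂ} (hH : H.IsHermitian) :
    traceNorm H = ∑ i, |hH.eigenvalues i| := by
  have hfin : (spectrum ℝ H).Finite := finite_real_spectrum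
  have h1 : Hᴴ * H = cfc (fun x : ℝ => x ^ 2) H := by
    rw [hH.eq, cfc_pow_id (R := ℝ) H 2 hH.isSelfAdjoint, sq]
  have h2 : cfc Real.sqrt (Hᴴ * H) = cfc (fun x : ℝ => |x|) H := by
    rw [h1, ← cfc_comp Real.sqrt (fun x : ℝ => x ^ 2) H hH.isSelfAdjoint
      ((hfin.image _).continuousOn _) (hfin.continuousOn _)]
    congr 1
    ext x
    simp [Real.sqrt_sq_eq_abs]
  obtain ⟨U, hU, -, -, hf⟩ := exists_unitary_cfc hH
  rw [traceNorm, h2, hf, trace_mul_comm, ← mul_assoc, hU, one_mul, trace_diagonal, Complex.re_sum]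
  simp

/-- In an eigenbasis of `A - B`, each eigenvalue is a difference of nonnegative diagonal entries of
`A` and `B`. -/
theorem traceNorm_sub_le {A B : Matrix ι ι ℂ} (hA : A.PosSemidef) (hB : B.PosSemidef) :
    traceNorm (A - B) ≤ A.trace.re + B.trace.re := by
  have hH : (A - B).IsHermitian := hA.isHermitian.sub hB.isHermitian
  obtain ⟨U, hU, hU', hs, -⟩ := exists_unitary_cfc hH
  have hd : diagonal (fun i => (hH.eigenvalues i : ℂ)) = Uᴴ * A * U - Uᴴ * B * U := by
    calc diagonal (fun i => (hH.eigenvalues i : ℂ))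
        = (Uᴴ * U) * diagonal (fun i => (hH.eigenvalues i : ℂ)) * (Uᴴ * U) := by simp [hU]
      _ = Uᴴ * (U * diagonal (fun i => (hH.eigenvalues i : ℂ)) * Uᴴ) * U := by noncomm_ring
      _ = _ := by rw [← hs]; noncomm_ring
  have key (i : ι) : |hH.eigenvalues i| ≤ ((Uᴴ * A * U) i i).re + ((Uᴴ * B * U) i i).re := by
    have h := congrArg Complex.re (congrFun (congrFun hd i) i)
    simp only [diagonal_apply_eq, Complex.ofReal_re, Matrix.sub_apply, Complex.sub_re] at h
    have ha : 0 ≤ ((Uᴴ * A * U) i i).re :=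
      (Complex.le_def.1 (hA.conjTranspose_mul_mul_same U).diag_nonneg).1
    have hb : 0 ≤ ((Uᴴ * B * U) i i).re :=
      (Complex.le_def.1 (hB.conjTranspose_mul_mul_same U).diag_nonneg).1
    rw [h, abs_le]
    constructor <;> linarith
  have htr (C : Matrix ι ι ℂ) : ∑ i, ((Uᴴ * C * U) i i).re = C.trace.re := by
    rw [← Complex.re_sum]
    change (Uᴴ * C * U).trace.re = _
    rw [trace_mul_comm, ← mul_assoc, hU', one_mul]
  rw [traceNorm_eq_sum hH, ← htr A, ← htr B, ← Finset.sum_add_distrib]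
  exact Finset.sum_le_sum fun i _ => key i

/-- The quadratic form averages the eigenvalues with weights `|y_i|² ≤ 1`. With `H` the error
operator and `x` the target state, this bounds the fidelity from below. -/
theorem neg_traceNorm_le {H : Matrix ι ι ℂ} (hH : H.IsHermitian) {x : ι → ℂ}
    (hx : star x ⬝ᵥ x = 1) : -traceNorm H ≤ (star x ⬝ᵥ H *ᵥ x).re := by
  obtain ⟨U, -, hU', hs, -⟩ := exists_unitary_cfc hH
  set y := Uᴴ *ᵥ x with hy
  have hsy : star y = star x ᵥ* U := by rw [hy, star_mulVec, conjTranspose_conjTranspose]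
  have hyy : star y ⬝ᵥ y = 1 := by
    rw [hsy, hy, ← dotProduct_mulVec, mulVec_mulVec, hU', one_mulVec, hx]
  have hquad : star x ⬝ᵥ H *ᵥ x = ∑ i, (hH.eigenvalues i : ℂ) * (Complex.normSq (y i) : ℂ) := by
    conv_lhs => rw [hs]
    rw [← mulVec_mulVec, ← mulVec_mulVec, dotProduct_mulVec, ← hsy, ← hy, dotProduct]
    refine Finset.sum_congr rfl fun i _ => ?_
    rw [mulVec_diagonal, Complex.normSq_eq_conj_mul_self, Pi.star_apply, ← starRingEnd_apply]
    ring
  have hsum : ∑ i, Complex.normSq (y i) = 1 := by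
    have : ((∑ i, Complex.normSq (y i) : ℝ) : ℂ) = 1 := by
      rw [← hyy, dotProduct, Complex.ofReal_sum]
      exact Finset.sum_congr rfl fun i _ => Complex.normSq_eq_conj_mul_self
    exact_mod_cast this
  rw [hquad, traceNorm_eq_sum hH, Complex.re_sum, ← Finset.sum_neg_distrib]
  refine Finset.sum_le_sum fun i _ => ?_
  rw [← Complex.ofReal_mul, Complex.ofReal_re]
  have h0 := Complex.normSq_nonneg (y i)
  have h1 : Complex.normSq (y i) ≤ 1 :=
    hsum ▸ Finset.single_le_sum (f := fun i => Complex.normSq (y i))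
      (fun j _ => Complex.normSq_nonneg _) (Finset.mem_univ i)
  have h2 := neg_abs_le (hH.eigenvalues i)
  have h3 := abs_nonneg (hH.eigenvalues i)
  nlinarith

/-- Spectral projections of shifts by a multiple of the identity. -/
theorem posProj_sub_smul_one {ρ : Matrix ι ι ℂ} (hρ : ρ.IsHermitian) (c : ℝ) :
    posProj (ρ - c • (1 : Matrix ι ι ℂ)) =
      cfc (fun x : ℝ => if c < x then (1 : ℝ) else 0) ρ := by
  -- On a finite spectrum every function is continuous, so the calculus composes even with the
  -- discontinuous indicator.
  have hfin : (spectrum ℝ ρ).Finite := finite_real_spectrum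
  have h1 : ρ - c • (1 : Matrix ι ι ℂ) = cfc (fun x : ℝ => x - c) ρ := by
    rw [cfc_sub (fun x : ℝ => x) (fun _ => c) ρ (hfin.continuousOn _) (hfin.continuousOn _),
      cfc_id' ℝ ρ hρ.isSelfAdjoint, cfc_const c ρ hρ.isSelfAdjoint,
      Algebra.algebraMap_eq_smul_one]
  rw [posProj, h1, ← cfc_comp _ (fun x : ℝ => x - c) ρ hρ.isSelfAdjoint
      ((hfin.image _).continuousOn _) (hfin.continuousOn _)]
  congr 1
  ext x
  simp [Set.indicator_apply]

end TraceNorm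

/-! ### Vectors of a tensor product as matrices -/

section VecDensity

variable {ι κ ι' κ' : Type*}

/-- The operator `|X⟩⟨X|` for the vector of `ℂ^ι ⊗ ℂ^κ` with coefficient matrix `X`. -/
def vecDensity (X : Matrix ι κ ℂ) : Matrix (ι × κ) (ι × κ) ℂ :=
  vecMulVec (vec Xᵀ) (star (vec Xᵀ))

/-- The coefficient matrix of a vector of `ℂ^ι ⊗ ℂ^κ`. -/
def coeffMatrix (ψ : EuclideanSpace ℂ (ι × κ)) : Matrix ι κ ℂ :=
  Matrix.of fun i j => ψ (i, j)

theorem pureDensity_eq (ψ : EuclideanSpace ℂ (ι × κ)) :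
    pureDensity ψ = vecDensity (coeffMatrix ψ) := rfl

theorem vecDensity_smul (c : ℂ) (X : Matrix ι κ ℂ) :
    vecDensity (c • X) = (c * star c) • vecDensity X := by
  ext p q
  simp [vecDensity, vecMulVec_apply]
  ring

theorem vecDensity_zero : vecDensity (0 : Matrix ι κ ℂ) = 0 := by
  ext p q
  simp [vecDensity, vecMulVec_apply]

theorem partialTraceB_vecDensity [Fintype κ] (X : Matrix ι κ ℂ) :
    partialTraceB (vecDensity X) = X * Xᴴ := by
  ext i j
  simp [partialTraceB, vecDensity, vecMulVec_apply, vec, mul_apply]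

variable [Fintype ι] [Fintype κ]

theorem posSemidef_vecDensity (X : Matrix ι κ ℂ) : (vecDensity X).PosSemidef :=
  posSemidef_vecMulVec_self_star _

theorem kronecker_mulVec_vec_transpose (A : Matrix ι' ι ℂ) (B : Matrix κ' κ ℂ)
    (X : Matrix ι κ ℂ) : (A ⊗ₖ B) *ᵥ vec Xᵀ = vec (A * X * Bᵀ)ᵀ := by
  rw [kronecker_mulVec_vec, transpose_mul, transpose_mul, transpose_transpose,
    Matrix.mul_assoc]

/-- Local operators become left and right multiplication of the coefficient matrix, so Schmidt rank
is matrix rank and no tensor bookkeeping is needed. -/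
theorem kronecker_conj_vecDensity (A : Matrix ι' ι ℂ) (B : Matrix κ' κ ℂ) (X : Matrix ι κ ℂ) :
    (A ⊗ₖ B) * vecDensity X * (A ⊗ₖ B)ᴴ = vecDensity (A * X * Bᵀ) := by
  rw [vecDensity, mul_vecMulVec, vecMulVec_mul, ← star_mulVec, kronecker_mulVec_vec_transpose]
  rfl

theorem star_vec_transpose_dotProduct (X Y : Matrix ι κ ℂ) :
    star (vec Xᵀ) ⬝ᵥ vec Yᵀ = (Xᴴ * Y).trace := by
  rw [star_vec_dotProduct_vec, ← trace_transpose, transpose_mul, transpose_transpose,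
    trace_mul_comm]
  rfl

theorem trace_vecDensity (X : Matrix ι κ ℂ) : (vecDensity X).trace = (X * Xᴴ).trace := by
  rw [vecDensity, trace_vecMulVec, dotProduct_comm, star_vec_transpose_dotProduct, trace_mul_comm]

theorem trace_mul_conjTranspose_coeffMatrix (ψ : EuclideanSpace ℂ (ι × κ)) (hψ : ‖ψ‖ = 1) :
    (coeffMatrix ψ * (coeffMatrix ψ)ᴴ).trace = 1 := by
  have h := EuclideanSpace.norm_sq_eq ψ
  rw [hψ, Fintype.sum_prod_type] at h
  simp only [trace, diag_apply, mul_apply, coeffMatrix, conjTranspose_apply, of_apply]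
  have h2 (z : ℂ) : z * star z = ((‖z‖ ^ 2 : ℝ) : ℂ) := by
    rw [← starRingEnd_apply, Complex.mul_conj, Complex.normSq_eq_norm_sq]
  simp only [h2]
  rw [one_pow] at h
  exact_mod_cast h.symm

end VecDensity

/-! ### Schmidt decomposition -/

/-- If `W` diagonalises `X Xᴴ`, the rows of `Wᴴ X` are orthogonal with the eigenvalues as squared
norms: drop the zero rows and normalise the others. The last clause turns spectral weights into sums
over Schmidt weights; zero eigenvalues contribute nothing there, whatever `f 0` is. -/
theorem exists_schmidt {a b : ℕ} (X : Matrix (Fin a) (Fin b) ℂ) :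
    ∃ (ι : Type) (_ : Fintype ι) (_ : DecidableEq ι) (p : ι → ℝ)
      (U : Matrix (Fin a) ι ℂ) (V : Matrix (Fin b) ι ℂ),
      (∀ k, 0 < p k) ∧ Uᴴ * U = 1 ∧ Vᴴ * V = 1 ∧
      X = U * diagonal (fun k => (√(p k) : ℂ)) * Vᵀ ∧
      ∀ f : ℝ → ℝ, ((X * Xᴴ) * cfc f (X * Xᴴ)).trace.re = ∑ k, p k * f (p k) := by
  have hpsd := posSemidef_self_mul_conjTranspose X
  have hρ : (X * Xᴴ).IsHermitian := hpsd.isHermitian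
  obtain ⟨W, hW, hW', hs, hf⟩ := exists_unitary_cfc hρ
  set e := hρ.eigenvalues with he
  have he0 : ∀ i, 0 ≤ e i := hpsd.eigenvalues_nonneg
  have hdiag : (Wᴴ * X) * (Wᴴ * X)ᴴ = diagonal (fun i => (e i : ℂ)) := by
    calc (Wᴴ * X) * (Wᴴ * X)ᴴ = Wᴴ * (X * Xᴴ) * W := by
          rw [conjTranspose_mul, conjTranspose_conjTranspose]; simp only [Matrix.mul_assoc]
      _ = (Wᴴ * W) * diagonal (fun i => (e i : ℂ)) * (Wᴴ * W) := by
          conv_lhs => rw [hs]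
          simp only [Matrix.mul_assoc]
      _ = _ := by simp [hW]
  let ι := {i : Fin a // 0 < e i}
  have hzero (i : Fin a) (hi : ¬ 0 < e i) (j : Fin b) : (Wᴴ * X) i j = 0 := by
    have h0 : e i = 0 := le_antisymm (not_lt.1 hi) (he0 i)
    have h := congrFun (congrFun hdiag i) i
    rw [diagonal_apply_eq, h0, mul_apply] at h
    have h2 : ∑ j, Complex.normSq ((Wᴴ * X) i j) = 0 := by
      have : ((∑ j, Complex.normSq ((Wᴴ * X) i j) : ℝ) : ℂ) = 0 := by
        rw [Complex.ofReal_sum]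
        simpa [← Complex.mul_conj] using h
      exact_mod_cast this
    have := (Finset.sum_eq_zero_iff_of_nonneg fun j _ => Complex.normSq_nonneg _).1 h2 j
      (Finset.mem_univ j)
    exact Complex.normSq_eq_zero.1 this
  have hsub {R : Type} [AddCommMonoid R] (g : Fin a → R) (hg : ∀ i, ¬ 0 < e i → g i = 0) :
      ∑ i, g i = ∑ k : ι, g k := by
    rw [← Finset.sum_subtype (Finset.univ.filter fun i => 0 < e i) (by simp) g,
      Finset.sum_filter_of_ne fun i _ hi => by_contra fun h => hi (hg i h)]
  have hsq (k : ι) : (√(e k) : ℂ) * (√(e k) : ℂ) = (e k : ℂ) := by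
    rw [← Complex.ofReal_mul, Real.mul_self_sqrt (he0 _)]
  have hsq0 (k : ι) : (√(e k) : ℂ) ≠ 0 := by
    exact_mod_cast (Real.sqrt_pos.2 k.2).ne'
  refine ⟨ι, inferInstance, inferInstance, fun k => e k, W.submatrix id Subtype.val,
    of fun j k => (√(e k) : ℂ)⁻¹ * (Wᴴ * X) k j, fun k => k.2, ?_, ?_, ?_, fun f => ?_⟩
  · ext k l
    have := congrFun (congrFun hW k) l
    rw [one_apply, mul_apply] at this
    rw [one_apply, if_congr Subtype.ext_iff rfl rfl]
    exact this
  · ext k l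
    have h := congrFun (congrFun hdiag l) k
    have h3 : (∑ j, (Wᴴ * X) l j * star ((Wᴴ * X) k j)) =
        if (l : Fin a) = k then (e l : ℂ) else 0 := by
      exact h
    calc _ = ((√(e k) : ℂ)⁻¹ * (√(e l) : ℂ)⁻¹) * ∑ j, (Wᴴ * X) l j * star ((Wᴴ * X) k j) := by
          rw [mul_apply, Finset.mul_sum]
          refine Finset.sum_congr rfl fun j _ => ?_
          simp only [conjTranspose_apply, of_apply, star_mul', star_inv₀]
          rw [show star (√(e k) : ℂ) = (√(e k) : ℂ) from Complex.conj_ofReal _]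
          ring
      _ = _ := by
          rw [h3, one_apply]
          by_cases hkl : k = l
          · subst hkl
            rw [if_pos rfl, if_pos rfl, ← hsq k]
            field_simp [hsq0 k]
          · rw [if_neg hkl, if_neg fun h => hkl (Subtype.ext h.symm), mul_zero]
  · have hX : X = W * (Wᴴ * X) := by rw [← Matrix.mul_assoc, hW', Matrix.one_mul]
    ext i j
    conv_lhs => rw [hX]
    rw [mul_apply, mul_apply, hsub _ fun l hl => by rw [hzero l hl, mul_zero]]
    refine Finset.sum_congr rfl fun k _ => ?_
    rw [mul_diagonal, submatrix_apply, transpose_apply, of_apply, mul_assoc,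
      mul_inv_cancel_left₀ (hsq0 k)]
    rfl
  · rw [hf]
    conv_lhs => enter [1, 1, 1]; rw [hs]
    have : W * diagonal (fun i => (e i : ℂ)) * Wᴴ *
        (W * diagonal (fun i => (f (e i) : ℂ)) * Wᴴ) =
        W * (diagonal (fun i => (e i : ℂ)) * (Wᴴ * W) *
          diagonal (fun i => (f (e i) : ℂ))) * Wᴴ := by simp only [Matrix.mul_assoc]
    rw [this, hW, Matrix.mul_one, diagonal_mul_diagonal, trace_mul_comm, ← Matrix.mul_assoc, hW,
      Matrix.one_mul, trace_diagonal, Complex.re_sum]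
    simp only [← Complex.ofReal_mul, Complex.ofReal_re]
    refine hsub _ fun l hl => ?_
    rw [le_antisymm (not_lt.1 hl) (he0 l), zero_mul]

/-! ### Hilbert-Schmidt norm -/

section Frobenius

variable {ι κ ν : Type*} [Fintype ι] [Fintype κ] [Fintype ν]

/-- The squared Hilbert-Schmidt norm. -/
def frobSq (X : Matrix ι κ ℂ) : ℝ := (Xᴴ * X).trace.re

theorem frobSq_eq_trace (X : Matrix ι κ ℂ) : (frobSq X : ℂ) = (Xᴴ * X).trace := by
  have h := (posSemidef_conjTranspose_mul_self X).trace_nonneg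
  rw [Complex.le_def] at h
  exact Complex.ext (by simp [frobSq]) (by simpa using h.2)

theorem frobSq_nonneg (X : Matrix ι κ ℂ) : 0 ≤ frobSq X :=
  (Complex.le_def.1 (posSemidef_conjTranspose_mul_self X).trace_nonneg).1

theorem trace_vecDensity_eq_frobSq (X : Matrix ι κ ℂ) : (vecDensity X).trace = frobSq X := by
  rw [trace_vecDensity, frobSq_eq_trace, trace_mul_comm]

theorem frobSq_coeffMatrix {ψ : EuclideanSpace ℂ (ι × κ)} (hψ : ‖ψ‖ = 1) :
    frobSq (coeffMatrix ψ) = 1 := by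
  rw [frobSq, trace_mul_comm, trace_mul_conjTranspose_coeffMatrix ψ hψ, Complex.one_re]

theorem normSq_trace_conjTranspose_mul_le (X Y : Matrix ι κ ℂ) :
    Complex.normSq (Xᴴ * Y).trace ≤ frobSq X * frobSq Y := by
  have hn (Z : Matrix ι κ ℂ) : ‖WithLp.toLp 2 (vec Z)‖ ^ 2 = frobSq Z := by
    rw [← inner_self_eq_norm_sq (𝕜 := ℂ), EuclideanSpace.inner_eq_star_dotProduct,
      dotProduct_comm, star_vec_dotProduct_vec]
    rfl
  have h := norm_inner_le_norm (𝕜 := ℂ) (WithLp.toLp 2 (vec X)) (WithLp.toLp 2 (vec Y))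
  rw [EuclideanSpace.inner_eq_star_dotProduct, dotProduct_comm, star_vec_dotProduct_vec] at h
  rw [Complex.normSq_eq_norm_sq, ← hn, ← hn, ← mul_pow]
  exact pow_le_pow_left₀ (norm_nonneg _) h 2

theorem transpose_mul_conjTranspose_transpose {ι κ : Type*} [Fintype ι] [DecidableEq κ]
    {V : Matrix ι κ ℂ} (hV : Vᴴ * V = 1) : Vᵀ * Vᵀᴴ = 1 := by
  rw [show Vᵀᴴ = Vᴴᵀ from rfl, ← transpose_mul, hV, transpose_one]

theorem frobSq_mul_diagonal_mul [DecidableEq ν] {U : Matrix ι ν ℂ} {V : Matrix κ ν ℂ}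
    (hU : Uᴴ * U = 1) (hV : Vᴴ * V = 1) (d : ν → ℝ) :
    frobSq (U * diagonal (fun k => (d k : ℂ)) * Vᵀ) = ∑ k, d k ^ 2 := by
  have hV' := transpose_mul_conjTranspose_transpose hV
  set D := diagonal (fun k => (d k : ℂ)) with hD
  have hDD : Dᴴ = D := by
    rw [hD, diagonal_conjTranspose]
    congr 1
    ext k
    exact Complex.conj_ofReal _
  have h : (U * D * Vᵀ)ᴴ * (U * D * Vᵀ) = Vᵀᴴ * (D * (Uᴴ * U) * D * Vᵀ) := by
    simp only [conjTranspose_mul, hDD, Matrix.mul_assoc]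
  rw [frobSq, h, hU, Matrix.mul_one, trace_mul_comm, Matrix.mul_assoc, hV', Matrix.mul_one, hD,
    diagonal_mul_diagonal, trace_diagonal, Complex.re_sum]
  refine Finset.sum_congr rfl fun k _ => ?_
  rw [← Complex.ofReal_mul, Complex.ofReal_re, sq]

theorem star_dotProduct_vecDensity_mulVec (Φ X : Matrix ι κ ℂ) :
    star (vec Φᵀ) ⬝ᵥ vecDensity X *ᵥ vec Φᵀ = (Complex.normSq (Φᴴ * X).trace : ℂ) := by
  rw [vecDensity, vecMulVec_mulVec, dotProduct_smul, star_vec_transpose_dotProduct,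
    star_vec_transpose_dotProduct, Complex.normSq_eq_conj_mul_self, starRingEnd_apply,
    ← trace_conjTranspose, conjTranspose_mul, conjTranspose_conjTranspose]
  simp [mul_comm]

end Frobenius

/-! ### Maximally entangled states -/

theorem IsMaxEntangled.exists_matrix {a b M : ℕ} {Φ : EuclideanSpace ℂ (Fin a × Fin b)}
    (h : IsMaxEntangled M Φ) :
    ∃ (E : Matrix (Fin a) (Fin M) ℂ) (F : Matrix (Fin b) (Fin M) ℂ),
      Eᴴ * E = 1 ∧ Fᴴ * F = 1 ∧ coeffMatrix Φ = (((√(M : ℝ))⁻¹ : ℝ) : ℂ) • (E * Fᵀ) := by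
  obtain ⟨-, e, f, he, hf, hΦ⟩ := h
  have key {c : ℕ} {g : Fin M → EuclideanSpace ℂ (Fin c)} (hg : Orthonormal ℂ g) :
      (of fun i k => g k i : Matrix (Fin c) (Fin M) ℂ)ᴴ * (of fun i k => g k i) = 1 := by
    ext k l
    rw [one_apply, ← orthonormal_iff_ite.1 hg k l, mul_apply, PiLp.inner_apply]
    refine Finset.sum_congr rfl fun i _ => ?_
    simp [mul_comm]
  refine ⟨of fun i k => e k i, of fun i k => f k i, key he, key hf, ?_⟩
  ext i j
  simp [coeffMatrix, hΦ, mul_apply]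

theorem isMaxEntangled_of_matrix {a b M : ℕ} (hM : 0 < M) {E : Matrix (Fin a) (Fin M) ℂ}
    {F : Matrix (Fin b) (Fin M) ℂ} (hE : Eᴴ * E = 1) (hF : Fᴴ * F = 1) :
    ∃ Φ : EuclideanSpace ℂ (Fin a × Fin b), IsMaxEntangled M Φ ∧
      coeffMatrix Φ = (((√(M : ℝ))⁻¹ : ℝ) : ℂ) • (E * Fᵀ) := by
  have key {c : ℕ} {G : Matrix (Fin c) (Fin M) ℂ} (hG : Gᴴ * G = 1) :
      Orthonormal ℂ fun k => (WithLp.toLp 2 fun i => G i k : EuclideanSpace ℂ (Fin c)) := by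
    rw [orthonormal_iff_ite]
    intro k l
    rw [← one_apply, ← hG, mul_apply, PiLp.inner_apply]
    refine Finset.sum_congr rfl fun i _ => ?_
    simp [mul_comm]
  refine ⟨WithLp.toLp 2 fun ij => (((√(M : ℝ))⁻¹ : ℝ) : ℂ) * ∑ k, E ij.1 k * F ij.2 k,
    ⟨hM, _, _, key hE, key hF, fun i j => rfl⟩, ?_⟩
  ext i j
  simp [coeffMatrix, mul_apply]

section Overlap

variable {a b M : ℕ} {E : Matrix (Fin a) (Fin M) ℂ} {F : Matrix (Fin b) (Fin M) ℂ}

theorem frobSq_maxEntangled (hM : 0 < M) (hE : Eᴴ * E = 1) (hF : Fᴴ * F = 1) :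
    frobSq ((((√(M : ℝ))⁻¹ : ℝ) : ℂ) • (E * Fᵀ)) = 1 := by
  have h : (((√(M : ℝ))⁻¹ : ℝ) : ℂ) • (E * Fᵀ) =
      E * diagonal (fun _ : Fin M => (((√(M : ℝ))⁻¹ : ℝ) : ℂ)) * Fᵀ := by
    rw [← smul_one_eq_diagonal, Matrix.mul_smul, Matrix.mul_one, Matrix.smul_mul]
  have hM' : (M : ℝ) ≠ 0 := by positivity
  rw [h, frobSq_mul_diagonal_mul hE hF]
  simp [hM']

/-- The overlap of a vector of Schmidt rank `r` with a maximally entangled state. -/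
theorem normSq_overlap_le (hM : 0 < M) (hE : Eᴴ * E = 1) (hF : Fᴴ * F = 1)
    (X : Matrix (Fin a) (Fin b) ℂ) {r : ℕ} (hr : X.rank ≤ r) :
    Complex.normSq (((((√(M : ℝ))⁻¹ : ℝ) : ℂ) • (E * Fᵀ))ᴴ * X).trace ≤
      r / M * frobSq X := by
  obtain ⟨ι, _, _, p, U, V, hp, hU, hV, hX, -⟩ := exists_schmidt X
  set Φ := (((√(M : ℝ))⁻¹ : ℝ) : ℂ) • (E * Fᵀ) with hΦ
  -- The number of Schmidt terms is at most the rank, because `U` factors through `X`.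
  have hcard : Fintype.card ι ≤ r := by
    have h1 : U = X * (Vᵀᴴ * diagonal (fun k => ((√(p k) : ℂ))⁻¹)) := by
      have h2 : diagonal (fun k => (√(p k) : ℂ)) * diagonal (fun k => ((√(p k) : ℂ))⁻¹) = 1 := by
        rw [diagonal_mul_diagonal, ← diagonal_one]
        congr 1
        ext k
        exact mul_inv_cancel₀ (by exact_mod_cast (Real.sqrt_pos.2 (hp k)).ne')
      conv_rhs => rw [hX]
      rw [← Matrix.mul_assoc, Matrix.mul_assoc _ Vᵀ, transpose_mul_conjTranspose_transpose hV,
        Matrix.mul_one, Matrix.mul_assoc, h2, Matrix.mul_one]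
    calc Fintype.card ι = (Uᴴ * U).rank := by rw [hU, rank_one]
      _ ≤ U.rank := rank_mul_le_right _ _
      _ ≤ X.rank := by
        conv_lhs => rw [h1]
        exact rank_mul_le_left _ _
      _ ≤ r := hr
  have hUX : U * (Uᴴ * X) = X := by
    rw [hX, ← Matrix.mul_assoc Uᴴ, ← Matrix.mul_assoc Uᴴ, hU, Matrix.one_mul, Matrix.mul_assoc]
  have h1 : (Φᴴ * X).trace = ((Uᴴ * Φ)ᴴ * (Uᴴ * X)).trace := by
    rw [conjTranspose_mul, conjTranspose_conjTranspose, Matrix.mul_assoc, hUX]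
  have h2 : frobSq (Uᴴ * X) = frobSq X := by
    rw [frobSq, conjTranspose_mul, conjTranspose_conjTranspose, Matrix.mul_assoc, hUX, frobSq]
  -- `Φ Φᴴ` is `1/M` times the projection `E Eᴴ`, and `Tr Uᴴ E Eᴴ U` is at most the number of
  -- columns of `U`. Cauchy–Schwarz on the range of `U` then finishes.
  have h3 : frobSq (Uᴴ * Φ) ≤ r / M := by
    have hFF := transpose_mul_conjTranspose_transpose hF
    have hM' : (0 : ℝ) < M := by exact_mod_cast hM
    have hΦΦ : Φ * Φᴴ = (((M : ℝ)⁻¹ : ℝ) : ℂ) • (E * Eᴴ) := by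
      rw [hΦ, conjTranspose_smul, conjTranspose_mul, Matrix.smul_mul, Matrix.mul_smul, smul_smul,
        ← Matrix.mul_assoc, Matrix.mul_assoc E, hFF, Matrix.mul_one]
      congr 1
      rw [← starRingEnd_apply, Complex.conj_ofReal, ← Complex.ofReal_mul, ← mul_inv,
        Real.mul_self_sqrt hM'.le]
    have hE1 : (1 - E * Eᴴ)ᴴ * (1 - E * Eᴴ) = 1 - E * Eᴴ := by
      have : E * Eᴴ * (E * Eᴴ) = E * Eᴴ := by
        rw [Matrix.mul_assoc, ← Matrix.mul_assoc Eᴴ, hE, Matrix.one_mul]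
      simp [conjTranspose_sub, conjTranspose_mul, Matrix.sub_mul, Matrix.mul_sub, this]
    have h4 : (frobSq (Uᴴ * Φ) : ℝ) = (M : ℝ)⁻¹ * (Uᴴ * (E * Eᴴ) * U).trace.re := by
      rw [frobSq, trace_mul_comm, conjTranspose_mul, conjTranspose_conjTranspose,
        show Uᴴ * Φ * (Φᴴ * U) = Uᴴ * (Φ * Φᴴ) * U by simp only [Matrix.mul_assoc], hΦΦ]
      simp only [Matrix.mul_smul, Matrix.smul_mul, trace_smul, smul_eq_mul, Complex.re_ofReal_mul]
    have h5 : (Uᴴ * (E * Eᴴ) * U).trace.re = Fintype.card ι - frobSq ((1 - E * Eᴴ) * U) := by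
      have : ((1 - E * Eᴴ) * U)ᴴ * ((1 - E * Eᴴ) * U) = 1 - Uᴴ * (E * Eᴴ) * U := by
        rw [conjTranspose_mul, Matrix.mul_assoc, ← Matrix.mul_assoc _ _ U, hE1, Matrix.sub_mul,
          Matrix.mul_sub, Matrix.one_mul, hU, Matrix.mul_assoc Uᴴ]
      rw [frobSq, this, trace_sub, trace_one]
      simp
    have h6 := frobSq_nonneg ((1 - E * Eᴴ) * U)
    have h7 : (Fintype.card ι : ℝ) ≤ r := by exact_mod_cast hcard
    rw [h4, h5, inv_mul_eq_div]
    gcongr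
    linarith
  rw [h1]
  refine (normSq_trace_conjTranspose_mul_le _ _).trans ?_
  rw [h2]
  exact mul_le_mul_of_nonneg_right h3 (frobSq_nonneg X)

end Overlap

/-! ### Kraus families of protocols -/

/-- LOCC maps are separable, which is all the converse uses. By induction on the protocol, each
round composes its local Kraus operator with those of the continuation. -/
theorem IsLOCC.exists_kraus {a' b' a b : ℕ}
    {L : Matrix (Fin a × Fin b) (Fin a × Fin b) ℂ → Matrix (Fin a' × Fin b') (Fin a' × Fin b') ℂ}
    (h : IsLOCC a' b' a b L) :
    ∃ (κ : Type) (_ : Fintype κ) (A : κ → Matrix (Fin a') (Fin a) ℂ)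
      (B : κ → Matrix (Fin b') (Fin b) ℂ),
      ∑ k, (A k ⊗ₖ B k)ᴴ * (A k ⊗ₖ B k) = 1 ∧
      ∀ X, L X = ∑ k, (A k ⊗ₖ B k) * X * (A k ⊗ₖ B k)ᴴ := by
  induction h with
  | done => exact ⟨Unit, inferInstance, fun _ => 1, fun _ => 1, by simp, by simp⟩
  | @alice a b m c K hK L _ ih =>
    choose κ fκ A B hAB hL using ih
    refine ⟨Σ k, κ k, inferInstance, fun x => A x.1 x.2 * K x.1, fun x => B x.1 x.2, ?_,
      fun X => ?_⟩
    · have hmul (k : Fin m) (j : κ k) : (A k j * K k) ⊗ₖ B k j =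
          (A k j ⊗ₖ B k j) * (K k ⊗ₖ (1 : Matrix (Fin b) (Fin b) ℂ)) := by
        rw [← mul_kronecker_mul, Matrix.mul_one]
      rw [Fintype.sum_sigma]
      simp only [hmul, conjTranspose_mul]
      calc _ = ∑ k, (K k ⊗ₖ (1 : Matrix (Fin b) (Fin b) ℂ))ᴴ *
            (∑ j, (A k j ⊗ₖ B k j)ᴴ * (A k j ⊗ₖ B k j)) *
            (K k ⊗ₖ (1 : Matrix (Fin b) (Fin b) ℂ)) := by
            simp only [Matrix.mul_sum, Matrix.sum_mul, Matrix.mul_assoc]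
        _ = ∑ k, ((K k)ᴴ * K k) ⊗ₖ (1 : Matrix (Fin b) (Fin b) ℂ) := by
            refine Finset.sum_congr rfl fun k _ => ?_
            rw [hAB, Matrix.mul_one, conjTranspose_kronecker, ← mul_kronecker_mul]
            simp
        _ = _ := by
            rw [← one_kronecker_one, ← hK]
            ext x y
            simp [Matrix.sum_apply, Finset.sum_mul]
    · rw [Fintype.sum_sigma]
      refine Finset.sum_congr rfl fun k _ => ?_
      rw [hL]
      refine Finset.sum_congr rfl fun j _ => ?_
      rw [show (A k j * K k) ⊗ₖ B k j =
        (A k j ⊗ₖ B k j) * (K k ⊗ₖ (1 : Matrix (Fin b) (Fin b) ℂ)) by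
          rw [← mul_kronecker_mul, Matrix.mul_one], conjTranspose_mul]
      simp only [Matrix.mul_assoc]
  | @bob a b m c K hK L _ ih =>
    choose κ fκ A B hAB hL using ih
    refine ⟨Σ k, κ k, inferInstance, fun x => A x.1 x.2, fun x => B x.1 x.2 * K x.1, ?_,
      fun X => ?_⟩
    · have hmul (k : Fin m) (j : κ k) : A k j ⊗ₖ (B k j * K k) =
          (A k j ⊗ₖ B k j) * ((1 : Matrix (Fin a) (Fin a) ℂ) ⊗ₖ K k) := by
        rw [← mul_kronecker_mul, Matrix.mul_one]
      rw [Fintype.sum_sigma]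
      simp only [hmul, conjTranspose_mul]
      calc _ = ∑ k, ((1 : Matrix (Fin a) (Fin a) ℂ) ⊗ₖ K k)ᴴ *
            (∑ j, (A k j ⊗ₖ B k j)ᴴ * (A k j ⊗ₖ B k j)) *
            ((1 : Matrix (Fin a) (Fin a) ℂ) ⊗ₖ K k) := by
            simp only [Matrix.mul_sum, Matrix.sum_mul, Matrix.mul_assoc]
        _ = ∑ k, (1 : Matrix (Fin a) (Fin a) ℂ) ⊗ₖ ((K k)ᴴ * K k) := by
            refine Finset.sum_congr rfl fun k _ => ?_
            rw [hAB, Matrix.mul_one, conjTranspose_kronecker, ← mul_kronecker_mul]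
            simp
        _ = _ := by
            rw [← one_kronecker_one, ← hK]
            ext x y
            simp [Matrix.sum_apply, Finset.mul_sum]
    · rw [Fintype.sum_sigma]
      refine Finset.sum_congr rfl fun k _ => ?_
      rw [hL]
      refine Finset.sum_congr rfl fun j _ => ?_
      rw [show A k j ⊗ₖ (B k j * K k) =
        (A k j ⊗ₖ B k j) * ((1 : Matrix (Fin a) (Fin a) ℂ) ⊗ₖ K k) by
          rw [← mul_kronecker_mul, Matrix.mul_one], conjTranspose_mul]
      simp only [Matrix.mul_assoc]

theorem sum_frobSq_kraus {ι κ ι' κ' ν : Type*} [Fintype ι] [Fintype κ] [Fintype ι'] [Fintype κ']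
    [Fintype ν] [DecidableEq ι] [DecidableEq κ] {A : ν → Matrix ι' ι ℂ} {B : ν → Matrix κ' κ ℂ}
    (h : ∑ k, (A k ⊗ₖ B k)ᴴ * (A k ⊗ₖ B k) = 1) (X : Matrix ι κ ℂ) :
    ∑ k, frobSq (A k * X * (B k)ᵀ) = frobSq X := by
  have : ((∑ k, frobSq (A k * X * (B k)ᵀ) : ℝ) : ℂ) = frobSq X := by
    rw [Complex.ofReal_sum]
    simp only [← trace_vecDensity_eq_frobSq, ← kronecker_conj_vecDensity]
    simp only [fun k => trace_mul_comm ((A k ⊗ₖ B k) * vecDensity X), ← Matrix.mul_assoc]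
    rw [← trace_sum, ← Matrix.sum_mul, h, Matrix.one_mul]
  exact_mod_cast this

/-- The difference of the two sides is `|tz - w|² / t`. The free parameter `t` makes the cross terms
cheap when `w` is small. -/
theorem normSq_add_le (z w : ℂ) {t : ℝ} (ht : 0 < t) :
    Complex.normSq (z + w) ≤ (1 + t) * Complex.normSq z + (1 + 1 / t) * Complex.normSq w := by
  have h : 0 ≤ Complex.normSq (t * z - w) / t := div_nonneg (Complex.normSq_nonneg _) ht.le
  have h2 : Complex.normSq (t * z - w) / t = (1 + t) * Complex.normSq z +
      (1 + 1 / t) * Complex.normSq w - Complex.normSq (z + w) := by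
    simp only [Complex.normSq_apply, Complex.add_re, Complex.add_im, Complex.sub_re,
      Complex.sub_im, Complex.re_ofReal_mul, Complex.im_ofReal_mul]
    field_simp
    ring
  linarith

/-- One-shot converse: a protocol that produces a maximally entangled state of Schmidt rank `M` up
to trace-norm error `η` forces the weight of the eigenvalues of `ρ_A` above `c` to be small. -/
theorem IsLOCC.trace_mul_posProj_le {a b M : ℕ} {ψ Φ : EuclideanSpace ℂ (Fin a × Fin b)}
    (hψ : ‖ψ‖ = 1) (hΦ : IsMaxEntangled M Φ)
    {L : Matrix (Fin a × Fin b) (Fin a × Fin b) ℂ → Matrix (Fin a × Fin b) (Fin a × Fin b) ℂ}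
    (hL : IsLOCC a b a b L) {c q : ℝ} (hc : 0 < c) (hq : 0 < q) (hcq : 1 / (c * M) ≤ q) :
    (partialTraceB (pureDensity ψ) *
      posProj (partialTraceB (pureDensity ψ) - c • (1 : Matrix (Fin a) (Fin a) ℂ))).trace.re ≤
      traceNorm (L (pureDensity ψ) - pureDensity Φ) + 2 * √q + q := by
  have hM := hΦ.1
  have hM' : (0 : ℝ) < M := by exact_mod_cast hM
  obtain ⟨E, F, hE, hF, hΦEF⟩ := hΦ.exists_matrix
  obtain ⟨κ, _, A, B, hAB, hLX⟩ := hL.exists_kraus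
  have hX1 := frobSq_coeffMatrix hψ
  rw [hLX, pureDensity_eq, pureDensity_eq, partialTraceB_vecDensity,
    posProj_sub_smul_one (posSemidef_self_mul_conjTranspose _).isHermitian]
  set X := coeffMatrix ψ
  have hΦ1 : frobSq (coeffMatrix Φ) = 1 := by rw [hΦEF, frobSq_maxEntangled hM hE hF]
  set Y := coeffMatrix Φ
  obtain ⟨ι, _, _, p, U, V, hp, hU, hV, hX, hf⟩ := exists_schmidt X
  rw [hf]
  simp only [kronecker_conj_vecDensity]
  set δ := ∑ k, p k * (if c < p k then 1 else 0) with hδ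
  set Xb := U * diagonal (fun k => ((if c < p k then √(p k) else 0 : ℝ) : ℂ)) * Vᵀ with hXb
  set Xg := U * diagonal (fun k => ((if c < p k then 0 else √(p k) : ℝ) : ℂ)) * Vᵀ with hXg
  have hXsum : X = Xg + Xb := by
    rw [hX, hXg, hXb, ← Matrix.add_mul, ← Matrix.mul_add, diagonal_add]
    congr 3
    ext k
    split_ifs <;> simp
  have hp1 : ∑ k, p k = 1 := by
    rw [← hX1, hX, frobSq_mul_diagonal_mul hU hV]
    exact Finset.sum_congr rfl fun k _ => (Real.sq_sqrt (hp k).le).symm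
  have hfb : frobSq Xb = δ := by
    rw [hXb, frobSq_mul_diagonal_mul hU hV]
    refine Finset.sum_congr rfl fun k _ => ?_
    split_ifs
    · rw [Real.sq_sqrt (hp k).le, mul_one]
    · simp
  have hfg : frobSq Xg = 1 - δ := by
    rw [hXg, frobSq_mul_diagonal_mul hU hV, ← hp1, hδ, ← Finset.sum_sub_distrib]
    refine Finset.sum_congr rfl fun k _ => ?_
    split_ifs
    · simp
    · rw [Real.sq_sqrt (hp k).le, mul_zero, sub_zero]
  have hδ0 : 0 ≤ δ := hfb ▸ frobSq_nonneg _
  have hδ1 : δ ≤ 1 := by have := frobSq_nonneg Xg; linarith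
  set r := Fintype.card {k // c < p k} with hr
  have hrank : Xb.rank ≤ r := by
    refine (rank_mul_le_left _ _).trans ((rank_mul_le_right _ _).trans ?_)
    rw [rank_diagonal, hr]
    refine Fintype.card_subtype_mono _ _ fun k hk => ?_
    by_contra h
    exact hk (by simp [h])
  -- Markov's inequality: `r` weights exceed `c` and the total is one.
  have hrc : r * c ≤ 1 := by
    calc (r : ℝ) * c = ∑ k ∈ Finset.univ.filter (fun k => c < p k), c := by
          rw [Finset.sum_const, hr, Fintype.card_subtype, nsmul_eq_mul]
      _ ≤ ∑ k ∈ Finset.univ.filter (fun k => c < p k), p k :=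
          Finset.sum_le_sum fun k hk => (Finset.mem_filter.1 hk).2.le
      _ ≤ ∑ k, p k := Finset.sum_le_sum_of_subset_of_nonneg (Finset.filter_subset _ _)
          fun k _ _ => (hp k).le
      _ = 1 := hp1
  have hrM : r / M ≤ q := by
    refine le_trans ?_ hcq
    rw [div_le_div_iff₀ hM' (by positivity)]
    nlinarith
  have hgood : ∑ k, Complex.normSq (Yᴴ * (A k * Xg * (B k)ᵀ)).trace ≤ 1 - δ := by
    rw [← hfg, ← sum_frobSq_kraus hAB Xg]
    refine Finset.sum_le_sum fun k _ => ?_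
    simpa [hΦ1] using normSq_trace_conjTranspose_mul_le Y (A k * Xg * (B k)ᵀ)
  have hbad : ∑ k, Complex.normSq (Yᴴ * (A k * Xb * (B k)ᵀ)).trace ≤ q := by
    calc _ ≤ ∑ k, (r / M : ℝ) * frobSq (A k * Xb * (B k)ᵀ) := by
          refine Finset.sum_le_sum fun k _ => ?_
          rw [hΦEF]
          exact normSq_overlap_le hM hE hF _
            ((rank_mul_le_left _ _).trans ((rank_mul_le_right _ _).trans hrank))
      _ = (r / M : ℝ) * δ := by rw [← Finset.mul_sum, sum_frobSq_kraus hAB, hfb]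
      _ ≤ q * 1 := mul_le_mul hrM hδ1 hδ0 hq.le
      _ = q := mul_one q
  -- Testing the error operator on the target itself gives fidelity at least one minus the
  -- trace-norm error.
  have hfid := neg_traceNorm_le (x := vec Yᵀ)
    (H := ∑ k, vecDensity (A k * X * (B k)ᵀ) - vecDensity Y)
    ((posSemidef_sum _ fun k _ => posSemidef_vecDensity _).isHermitian.sub
      (posSemidef_vecDensity _).isHermitian)
    (by rw [star_vec_transpose_dotProduct, ← frobSq_eq_trace, hΦ1, Complex.ofReal_one])
  rw [sub_mulVec, dotProduct_sub, sum_mulVec, dotProduct_sum] at hfid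
  simp only [star_dotProduct_vecDensity_mulVec] at hfid
  rw [← frobSq_eq_trace, hΦ1, ← Complex.ofReal_sum, ← Complex.ofReal_sub, Complex.ofReal_re,
    Complex.ofReal_one, Complex.normSq_one] at hfid
  have ht : 0 < √q := Real.sqrt_pos.2 hq
  -- The choice `t = √q` balances `t` against `q / t`, which is where `2√q + q` comes from.
  have hmink : ∑ k, Complex.normSq (Yᴴ * (A k * X * (B k)ᵀ)).trace ≤
      (1 + √q) * (1 - δ) + (1 + 1 / √q) * q := by
    calc _ ≤ ∑ k, ((1 + √q) * Complex.normSq (Yᴴ * (A k * Xg * (B k)ᵀ)).trace +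
          (1 + 1 / √q) * Complex.normSq (Yᴴ * (A k * Xb * (B k)ᵀ)).trace) := by
          refine Finset.sum_le_sum fun k _ => ?_
          rw [hXsum, Matrix.mul_add, Matrix.add_mul, Matrix.mul_add, trace_add]
          exact normSq_add_le _ _ ht
      _ ≤ _ := by
          rw [Finset.sum_add_distrib, ← Finset.mul_sum, ← Finset.mul_sum]
          gcongr
  have hqq : (1 + 1 / √q) * q = q + √q := by
    have := Real.mul_self_sqrt hq.le
    field_simp
    nlinarith
  nlinarith

/-! ### The hypersimplex -/

section Hypersimplex

variable {ι : Type*} [Fintype ι] [DecidableEq ι]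

/-- Moving mass from `j` to `i` until one of the two coordinates becomes integral. -/
theorem exists_shift_card_lt {x : ι → ℝ} (h0 : ∀ k, 0 ≤ x k) (h1 : ∀ k, x k ≤ 1) {i j : ι}
    (hij : i ≠ j) (hi : 0 < x i ∧ x i < 1) (hj : 0 < x j ∧ x j < 1) :
    ∃ (d : ℝ) (y : ι → ℝ), 0 < d ∧
      (∀ k, y k = x k + d * ((if k = i then 1 else 0) - (if k = j then 1 else 0))) ∧
      (∀ k, 0 ≤ y k) ∧ (∀ k, y k ≤ 1) ∧ ∑ k, y k = ∑ k, x k ∧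
      (Finset.univ.filter fun k => 0 < y k ∧ y k < 1).card <
        (Finset.univ.filter fun k => 0 < x k ∧ x k < 1).card := by
  set d := min (1 - x i) (x j) with hd
  have hdi : d ≤ 1 - x i := min_le_left _ _
  have hdj : d ≤ x j := min_le_right _ _
  have hd0 : 0 < d := lt_min (by linarith) hj.1
  set y : ι → ℝ := fun k => x k + d * ((if k = i then 1 else 0) - (if k = j then 1 else 0))
    with hy
  have hyi : y i = x i + d := by simp [hy, hij]
  have hyj : y j = x j - d := by simp [hy, hij.symm]; ring
  have hyk (k : ι) (hki : k ≠ i) (hkj : k ≠ j) : y k = x k := by simp [hy, hki, hkj]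
  refine ⟨d, y, hd0, fun k => rfl, fun k => ?_, fun k => ?_, ?_, Finset.card_lt_card ?_⟩
  · rcases eq_or_ne k i with rfl | hki
    · linarith [hi.1]
    rcases eq_or_ne k j with rfl | hkj
    · linarith
    · rw [hyk k hki hkj]; exact h0 k
  · rcases eq_or_ne k i with rfl | hki
    · linarith
    rcases eq_or_ne k j with rfl | hkj
    · linarith [hj.2]
    · rw [hyk k hki hkj]; exact h1 k
  · simp [hy, Finset.sum_add_distrib, ← Finset.mul_sum, Finset.sum_sub_distrib]
  · have hsub (k : ι) (hk : 0 < y k ∧ y k < 1) : 0 < x k ∧ x k < 1 := by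
      rcases eq_or_ne k i with rfl | hki
      · exact hi
      rcases eq_or_ne k j with rfl | hkj
      · exact hj
      · rwa [hyk k hki hkj] at hk
    rw [Finset.ssubset_iff_of_subset fun k hk => by
      simp only [Finset.mem_filter, Finset.mem_univ, true_and] at hk ⊢; exact hsub k hk]
    rcases min_choice (1 - x i) (x j) with h | h
    · refine ⟨i, by simpa using hi, fun hmem => ?_⟩
      have := (Finset.mem_filter.1 hmem).2.2
      rw [hyi, hd, h] at this
      linarith
    · refine ⟨j, by simpa using hj, fun hmem => ?_⟩
      have := (Finset.mem_filter.1 hmem).2.1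
      rw [hyj, hd, h] at this
      linarith

/-- A point of the cube with integral coordinate sum `M` is a convex combination of indicators of
`M`-element sets. -/
theorem exists_hypersimplex_weights {M : ℕ} (x : ι → ℝ) (h0 : ∀ k, 0 ≤ x k) (h1 : ∀ k, x k ≤ 1)
    (hs : ∑ k, x k = M) :
    ∃ w : (Fin M ↪ ι) → ℝ, (∀ τ, 0 ≤ w τ) ∧ ∑ τ, w τ = 1 ∧
      ∀ k, ∑ τ, w τ * ∑ i, (if τ i = k then 1 else 0) = x k := by
  induction hm : (Finset.univ.filter fun k => 0 < x k ∧ x k < 1).card using Nat.strong_induction_on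
    generalizing x with
  | _ m ih =>
  subst hm
  by_cases hfrac : ∃ i, 0 < x i ∧ x i < 1
  · obtain ⟨i, hi⟩ := hfrac
    -- A single fractional coordinate would make the sum non-integral, so there is a second one.
    obtain ⟨j, hij, hj⟩ : ∃ j, i ≠ j ∧ (0 < x j ∧ x j < 1) := by
      by_contra! hno
      have hint (k : ι) (hk : k ≠ i) : x k = if x k = 1 then 1 else 0 := by
        split_ifs with h
        · exact h
        · by_contra h'
          exact h (le_antisymm (h1 k) (hno k hk.symm ((h0 k).lt_of_ne' h')))
      have hsum : x i + ((Finset.univ.erase i).filter fun k => x k = 1).card = M := by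
        rw [← hs, ← Finset.add_sum_erase _ _ (Finset.mem_univ i), Finset.card_filter]
        push_cast
        congr 1
        exact (Finset.sum_congr rfl fun k hk => hint k (Finset.ne_of_mem_erase hk)).symm
      set N := ((Finset.univ.erase i).filter fun k => x k = 1).card
      have ha : (N : ℝ) < M := by linarith [hi.1]
      have hb : (M : ℝ) < N + 1 := by linarith [hi.2]
      have ha' : N < M := by exact_mod_cast ha
      have hb' : M < N + 1 := by exact_mod_cast hb
      omega
    obtain ⟨d, y, hd, hy, hy0, hy1, hys, hyc⟩ := exists_shift_card_lt h0 h1 hij hi hj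
    obtain ⟨e, z, he, hz, hz0, hz1, hzs, hzc⟩ := exists_shift_card_lt h0 h1 hij.symm hj hi
    obtain ⟨u, hu0, hu1, hu⟩ := ih _ hyc y hy0 hy1 (hys.trans hs) rfl
    obtain ⟨v, hv0, hv1, hv⟩ := ih _ hzc z hz0 hz1 (hzs.trans hs) rfl
    -- The shifts `y` and `z` move `x` by `d` and `e` in opposite directions, so `x` is their
    -- average with weights proportional to `e` and `d`.
    refine ⟨fun τ => e / (d + e) * u τ + d / (d + e) * v τ, fun τ => ?_, ?_, fun k => ?_⟩
    · have := hu0 τ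
      have := hv0 τ
      positivity
    · rw [Finset.sum_add_distrib, ← Finset.mul_sum, ← Finset.mul_sum, hu1, hv1]
      field_simp
      ring
    · simp only [add_mul, mul_assoc]
      rw [Finset.sum_add_distrib, ← Finset.mul_sum, ← Finset.mul_sum, hu, hv, hy, hz]
      field_simp
      ring
  · push Not at hfrac
    have hint (k : ι) : x k = if x k = 1 then 1 else 0 := by
      split_ifs with h
      · exact h
      · by_contra h'
        exact h (le_antisymm (h1 k) (hfrac k ((h0 k).lt_of_ne' h')))
    have hcard : (Finset.univ.filter fun k => x k = 1).card = M := by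
      have : ((Finset.univ.filter fun k => x k = 1).card : ℝ) = M := by
        rw [← hs, Finset.card_filter]
        push_cast
        exact (Finset.sum_congr rfl fun k _ => hint k).symm
      exact_mod_cast this
    let e := Finset.equivFinOfCardEq hcard
    let τ : Fin M ↪ ι := e.symm.toEmbedding.trans (Function.Embedding.subtype _)
    refine ⟨Pi.single τ 1, fun σ => ?_, by simp, fun k => ?_⟩
    · rw [Pi.single_apply]
      split_ifs <;> norm_num
    · rw [Finset.sum_eq_single τ (fun σ _ hσ => by rw [Pi.single_eq_of_ne hσ, zero_mul])
        (by simp), Pi.single_eq_same, one_mul, hint k]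
      split_ifs with hk
      · have hk' : k ∈ Finset.univ.filter fun k => x k = 1 := by simpa using hk
        have hval : τ (e ⟨k, hk'⟩) = k := by simp [τ]
        rw [Finset.sum_eq_single (e ⟨k, hk'⟩), if_pos hval]
        · intro l _ hl
          exact if_neg fun h => hl (τ.injective (h.trans hval.symm))
        · simp
      · refine Finset.sum_eq_zero fun l _ => if_neg fun h => hk ?_
        rw [← h]
        exact (Finset.mem_filter.1 (e.symm l).2).2

end Hypersimplex

/-! ### Protocols -/

section Protocols

variable {a' b' a b : ℕ} {J : Type*} [Fintype J]

theorem IsLOCC.alice_of_fintype (c : J → ℕ) (K : ∀ k, Matrix (Fin (c k)) (Fin a) ℂ)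
    (hK : ∑ k, (K k)ᴴ * K k = 1)
    (L : ∀ k, Matrix (Fin (c k) × Fin b) (Fin (c k) × Fin b) ℂ →
      Matrix (Fin a' × Fin b') (Fin a' × Fin b') ℂ)
    (hL : ∀ k, IsLOCC a' b' (c k) b (L k)) :
    IsLOCC a' b' a b (fun X => ∑ k, L k ((K k ⊗ₖ (1 : Matrix (Fin b) (Fin b) ℂ)) * X *
      (K k ⊗ₖ (1 : Matrix (Fin b) (Fin b) ℂ))ᴴ)) := by
  let e := Fintype.equivFin J
  have h := IsLOCC.alice (fun k => c (e.symm k)) (fun k => K (e.symm k))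
    ((e.symm.sum_comp fun k => (K k)ᴴ * K k).trans hK) (fun k => L (e.symm k))
    (fun k => hL (e.symm k))
  convert h using 2 with X
  exact (e.symm.sum_comp fun k => L k ((K k ⊗ₖ (1 : Matrix (Fin b) (Fin b) ℂ)) * X *
      (K k ⊗ₖ (1 : Matrix (Fin b) (Fin b) ℂ))ᴴ)).symm

theorem conjTranspose_one_sub_mul_self {ι : Type*} [Fintype ι] [DecidableEq ι]
    {P : Matrix ι ι ℂ} (hP : Pᴴ = P) (hPP : P * P = P) : (1 - P)ᴴ * (1 - P) = 1 - P := by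
  simp [conjTranspose_sub, hP, Matrix.sub_mul, Matrix.mul_sub, hPP]

/-- Bob can rotate one isometry into another. -/
theorem exists_isLOCC_rotate {M : ℕ} {F V : Matrix (Fin b) (Fin M) ℂ} (hF : Fᴴ * F = 1)
    (hV : Vᴴ * V = 1) :
    ∃ L, IsLOCC a b a b L ∧
      ∀ Y : Matrix (Fin a) (Fin M) ℂ, L (vecDensity (Y * Vᵀ)) = vecDensity (Y * Fᵀ) := by
  have hVV := transpose_mul_conjTranspose_transpose hV
  have h1 : (1 - V * Vᴴ)ᴴ * (1 - V * Vᴴ) = 1 - V * Vᴴ := by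
    refine conjTranspose_one_sub_mul_self ?_ ?_
    · rw [conjTranspose_mul, conjTranspose_conjTranspose]
    · rw [Matrix.mul_assoc, ← Matrix.mul_assoc Vᴴ, hV, Matrix.one_mul]
  have h2 : (F * Vᴴ)ᴴ * (F * Vᴴ) = V * Vᴴ := by
    rw [conjTranspose_mul, conjTranspose_conjTranspose, Matrix.mul_assoc, ← Matrix.mul_assoc Fᴴ,
      hF, Matrix.one_mul]
  -- The partial isometry `F Vᴴ` is completed to a measurement instead of being extended to a
  -- unitary; the second outcome annihilates the states in question.
  refine ⟨_, IsLOCC.bob (m := 2) (fun _ => b) ![F * Vᴴ, 1 - V * Vᴴ]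
    (by
      rw [Fin.sum_univ_two]
      exact (congrArg₂ (· + ·) h2 h1).trans (add_sub_cancel _ _)) (fun _ X => X) (fun _ => IsLOCC.done), fun Y => ?_⟩
  simp only [kronecker_conj_vecDensity, Fin.sum_univ_two, Matrix.cons_val_zero,
    Matrix.cons_val_one, Matrix.one_mul]
  have h3 : Y * Vᵀ * (F * Vᴴ)ᵀ = Y * Fᵀ := by
    rw [transpose_mul, Matrix.mul_assoc, ← Matrix.mul_assoc Vᵀ, show Vᴴᵀ = Vᵀᴴ from rfl, hVV,
      Matrix.one_mul]
  have h4 : Y * Vᵀ * (1 - V * Vᴴ)ᵀ = 0 := by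
    rw [transpose_sub, transpose_one, transpose_mul, Matrix.mul_assoc, Matrix.mul_sub,
      ← Matrix.mul_assoc Vᵀ, show Vᴴᵀ = Vᵀᴴ from rfl, hVV, Matrix.mul_one, Matrix.one_mul,
      sub_self, Matrix.mul_zero]
  rw [h3, h4, vecDensity_zero, add_zero]

theorem submatrix_isometry {ι κ ν : Type*} [Fintype ι] [DecidableEq κ] [DecidableEq ν]
    {U : Matrix ι κ ℂ} (hU : Uᴴ * U = 1) (τ : ν ↪ κ) :
    (U.submatrix id τ)ᴴ * U.submatrix id τ = 1 := by
  rw [← submatrix_one τ τ.injective, ← hU]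
  rfl

/-- Rewrites Alice's effect for one outcome `τ` in the full Schmidt basis, with the indicator sums
of `exists_hypersimplex_weights`, so that the effects can be added. -/
theorem submatrix_mul_diagonal_mul_conjTranspose {ι κ ν : Type*} [Fintype κ] [Fintype ν]
    [DecidableEq κ] [DecidableEq ν] (U : Matrix ι κ ℂ) (τ : ν → κ) (d : κ → ℝ) :
    U.submatrix id τ * diagonal (fun i => (d (τ i) : ℂ)) * (U.submatrix id τ)ᴴ =
      U * diagonal (fun k => ((d k * ∑ i, (if τ i = k then 1 else 0) : ℝ) : ℂ)) * Uᴴ := by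
  ext i j
  rw [mul_apply, mul_apply]
  simp only [mul_diagonal, submatrix_apply, conjTranspose_apply, id]
  have h (k : κ) : U i k * ((d k * ∑ l, (if τ l = k then 1 else 0) : ℝ) : ℂ) * star (U j k) =
      ∑ l, if τ l = k then U i k * (d k : ℂ) * star (U j k) else 0 := by
    push_cast
    rw [Finset.mul_sum, Finset.mul_sum, Finset.sum_mul]
    refine Finset.sum_congr rfl fun l _ => ?_
    split_ifs <;> simp
  simp only [h]
  rw [Finset.sum_comm]
  simp

end Protocols

/-- One-shot concentration: cutting off the eigenvalues of `ρ_A` above `c` produces a maximally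
entangled state of Schmidt rank about `1 / c`, with error controlled by the weight cut off. -/
theorem exists_isLOCC_concentration {a b : ℕ} {ψ : EuclideanSpace ℂ (Fin a × Fin b)}
    (hψ : ‖ψ‖ = 1) {c ε : ℝ} (hc : 0 < c)
    (hε : (partialTraceB (pureDensity ψ) * posProj (partialTraceB (pureDensity ψ) -
      c • (1 : Matrix (Fin a) (Fin a) ℂ))).trace.re = ε) :
    ∃ (M : ℕ) (Φ : EuclideanSpace ℂ (Fin a × Fin b))
      (L : Matrix (Fin a × Fin b) (Fin a × Fin b) ℂ → Matrix (Fin a × Fin b) (Fin a × Fin b) ℂ),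
      IsMaxEntangled M Φ ∧ IsLOCC a b a b L ∧
      traceNorm (L (pureDensity ψ) - pureDensity Φ) ≤ 2 * ε ∧ (1 - ε) / (2 * c) ≤ M := by
  have hX1 := frobSq_coeffMatrix hψ
  simp only [pureDensity_eq, partialTraceB_vecDensity] at hε ⊢
  rw [posProj_sub_smul_one (posSemidef_self_mul_conjTranspose _).isHermitian] at hε
  set X := coeffMatrix ψ
  obtain ⟨ι, _, _, p, U, V, hp, hU, hV, hX, hf⟩ := exists_schmidt X
  rw [hf] at hε
  have hp1 : ∑ k, p k = 1 := by
    rw [← hX1, hX, frobSq_mul_diagonal_mul hU hV]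
    exact Finset.sum_congr rfl fun k _ => (Real.sq_sqrt (hp k).le).symm
  set s := ∑ k, (if c < p k then 0 else p k) with hs
  have hsε : s = 1 - ε := by
    refine eq_sub_of_add_eq (Eq.trans ?_ hp1)
    rw [← hε, hs, ← Finset.sum_add_distrib]
    refine Finset.sum_congr rfl fun k _ => ?_
    split_ifs <;> simp
  have hs0 : 0 ≤ s := Finset.sum_nonneg fun k _ => by
    split_ifs
    exacts [le_rfl, (hp k).le]
  have hε0 : 0 ≤ ε := by
    rw [← hε]
    refine Finset.sum_nonneg fun k _ => mul_nonneg (hp k).le ?_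
    split_ifs <;> norm_num
  -- If all the weight is cut off then `ε = 1`, and doing nothing meets the error bound `2` with `M
  -- = 1`.
  rcases hs0.eq_or_lt with hs0 | hs0
  · have hne : Nonempty ι := by
      by_contra h
      rw [not_nonempty_iff] at h
      simp at hp1
    obtain ⟨k⟩ := hne
    let τ : Fin 1 ↪ ι := ⟨fun _ => k, fun _ _ _ => Subsingleton.elim _ _⟩
    obtain ⟨Φ, hΦ, hΦEF⟩ := isMaxEntangled_of_matrix one_pos (submatrix_isometry hU τ)
      (submatrix_isometry hV τ)
    refine ⟨1, Φ, _, hΦ, IsLOCC.done, ?_, ?_⟩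
    · refine (traceNorm_sub_le (posSemidef_vecDensity _) (posSemidef_vecDensity _)).trans ?_
      rw [trace_vecDensity_eq_frobSq, trace_vecDensity_eq_frobSq, hX1, hΦEF,
        frobSq_maxEntangled one_pos (submatrix_isometry hU τ) (submatrix_isometry hV τ)]
      simp only [Complex.ofReal_one, Complex.one_re]
      linarith
    · rw [← hsε, ← hs0]
      simp
  -- The rank must be positive. When the floor vanishes, `M = 1` still keeps the rescaled weights `p
  -- k / s` below one. In all cases `s / c < ⌊s / c⌋₊ + 1 ≤ 2 * M`, hence the factor `2` in the rank
  -- bound.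
  set M := max 1 ⌊s / c⌋₊ with hMdef
  have hM : 0 < M := lt_of_lt_of_le one_pos (le_max_left _ _)
  have hM' : (0 : ℝ) < M := by exact_mod_cast hM
  have hMs : (M : ℝ) = 1 ∨ M * c ≤ s := by
    rcases le_total ⌊s / c⌋₊ 1 with h | h
    · left
      rw [hMdef, max_eq_left h, Nat.cast_one]
    · right
      rw [hMdef, max_eq_right h, ← le_div_iff₀ hc]
      exact Nat.floor_le (by positivity)
  have hMlow : (1 - ε) / (2 * c) ≤ M := by
    have h1 : (1 : ℝ) ≤ M := by exact_mod_cast le_max_left 1 ⌊s / c⌋₊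
    have h2 : (⌊s / c⌋₊ : ℝ) ≤ M := by exact_mod_cast le_max_right 1 ⌊s / c⌋₊
    have h3 := Nat.lt_floor_add_one (s / c)
    rw [← hsε, show s / (2 * c) = s / c / 2 by field_simp]
    linarith
  set x : ι → ℝ := fun k => M / s * if c < p k then 0 else p k with hx
  have hx0 (k : ι) : 0 ≤ x k := by
    simp only [hx]
    split_ifs
    · simp
    · have := hp k
      positivity
  have hpos (k : ι) : 0 ≤ (if c < p k then 0 else p k) := by
    split_ifs
    exacts [le_rfl, (hp k).le]
  have hx1 (k : ι) : x k ≤ 1 := by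
    simp only [hx]
    rw [div_mul_eq_mul_div, div_le_one hs0]
    rcases hMs with h | h
    · rw [h, one_mul]
      exact Finset.single_le_sum (f := fun k => if c < p k then 0 else p k)
        (fun k _ => hpos k) (Finset.mem_univ k)
    · split_ifs with hk
      · simpa using hs0.le
      · exact (mul_le_mul_of_nonneg_left (not_lt.1 hk) hM'.le).trans h
  have hxs : ∑ k, x k = M := by
    rw [← Finset.mul_sum, ← hs, div_mul_cancel₀ _ hs0.ne']
  obtain ⟨w, hw0, hw1, hw⟩ := exists_hypersimplex_weights x hx0 hx1 hxs
  obtain ⟨τ₀⟩ : Nonempty (Fin M ↪ ι) := by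
    by_contra h
    rw [not_nonempty_iff] at h
    simp at hw1
  have hE := submatrix_isometry hU τ₀
  have hF := submatrix_isometry hV τ₀
  set E := U.submatrix id τ₀
  set F := V.submatrix id τ₀
  obtain ⟨Φ, hΦ, hΦEF⟩ := isMaxEntangled_of_matrix hM hE hF
  have hΦ1 : frobSq (coeffMatrix Φ) = 1 := by rw [hΦEF, frobSq_maxEntangled hM hE hF]
  choose B hB hBV using fun τ : Fin M ↪ ι =>
    exists_isLOCC_rotate (a := a) hF (submatrix_isometry hV τ)
  -- Alice's measurement
  set P := U * diagonal (fun k => ((if c < p k then 0 else 1 : ℝ) : ℂ)) * Uᴴ with hP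
  -- Since `x` is proportional to the kept weights, the factor `√(w τ / x)` flattens the Schmidt
  -- coefficients selected by `τ`, and `E` moves them to the target. Averaging over `τ` gives `x / x
  -- = 1` on kept indices, so the effects sum to `P`; `none` is failure.
  set K : Option (Fin M ↪ ι) → Matrix (Fin a) (Fin a) ℂ := fun o => o.elim (1 - P) fun τ =>
    E * diagonal (fun i => (√(w τ / x (τ i)) : ℂ)) * (U.submatrix id τ)ᴴ with hK
  have hPP : P * P = P := by
    rw [hP, show ∀ D : Matrix ι ι ℂ, U * D * Uᴴ * (U * D * Uᴴ) = U * (D * (Uᴴ * U) * D) * Uᴴ by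
      intro D; simp only [Matrix.mul_assoc], hU, Matrix.mul_one, diagonal_mul_diagonal]
    congr 3
    ext k
    split_ifs <;> simp
  have hPstar : Pᴴ = P := by
    rw [hP, conjTranspose_mul, conjTranspose_mul, conjTranspose_conjTranspose,
      diagonal_conjTranspose, ← Matrix.mul_assoc]
    congr 3
    ext k
    exact Complex.conj_ofReal _
  have hKsome (τ : Fin M ↪ ι) : (K (some τ))ᴴ * K (some τ) =
      U * diagonal (fun k => ((w τ / x k * ∑ i, (if τ i = k then 1 else 0) : ℝ) : ℂ)) * Uᴴ := by
    rw [← submatrix_mul_diagonal_mul_conjTranspose U τ fun k => w τ / x k]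
    simp only [hK, Option.elim_some, conjTranspose_mul, conjTranspose_conjTranspose]
    rw [show ∀ D : Matrix (Fin M) (Fin M) ℂ, U.submatrix id τ * (Dᴴ * Eᴴ) *
      (E * D * (U.submatrix id τ)ᴴ) = U.submatrix id τ * (Dᴴ * (Eᴴ * E) * D) *
      (U.submatrix id τ)ᴴ by intro D; simp only [Matrix.mul_assoc], hE, Matrix.mul_one,
      diagonal_conjTranspose, diagonal_mul_diagonal]
    congr 3
    ext i
    rw [Pi.star_apply, ← starRingEnd_apply, Complex.conj_ofReal, ← Complex.ofReal_mul,
      Real.mul_self_sqrt (div_nonneg (hw0 τ) (hx0 _))]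
  have hKsum : ∑ o, (K o)ᴴ * K o = 1 := by
    rw [Fintype.sum_option]
    have h1 : (K none)ᴴ * K none = 1 - P := conjTranspose_one_sub_mul_self hPstar hPP
    have h2 : ∑ τ, (K (some τ))ᴴ * K (some τ) = P := by
      simp only [hKsome]
      rw [← Matrix.sum_mul, ← Matrix.mul_sum, hP]
      congr 2
      ext k l
      rw [Matrix.sum_apply]
      rcases eq_or_ne k l with rfl | hkl
      · simp only [diagonal_apply_eq]
        rw [← Complex.ofReal_sum]
        congr 1
        simp only [div_mul_eq_mul_div]
        rw [← Finset.sum_div, hw]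
        have := hp k
        by_cases hk : c < p k
        · simp [hx, hk]
        · rw [if_neg hk, div_self]
          simp only [hx, if_neg hk]
          positivity
      · simp [diagonal_apply_ne _ hkl]
    rw [h1, h2, sub_add_cancel]
  have hKX (τ : Fin M ↪ ι) : K (some τ) * X =
      (((√(w τ * s / M) : ℝ) : ℂ) • E) * (V.submatrix id τ)ᵀ := by
    have h1 : (U.submatrix id τ)ᴴ * X =
        diagonal (fun i => (√(p (τ i)) : ℂ)) * (V.submatrix id τ)ᵀ := by
      have h2 : Uᴴ * X = diagonal (fun k => (√(p k) : ℂ)) * Vᵀ := by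
        rw [hX, ← Matrix.mul_assoc, ← Matrix.mul_assoc, hU, Matrix.one_mul]
      ext i j
      rw [diagonal_mul]
      have h3 := congrFun (congrFun h2 (τ i)) j
      rw [diagonal_mul] at h3
      exact h3
    have h4 : diagonal (fun i => (√(w τ / x (τ i)) : ℂ)) * diagonal (fun i => (√(p (τ i)) : ℂ)) =
        ((√(w τ * s / M) : ℝ) : ℂ) • (1 : Matrix (Fin M) (Fin M) ℂ) := by
      rw [diagonal_mul_diagonal, smul_one_eq_diagonal]
      congr 1
      ext i
      rw [← Complex.ofReal_mul, ← Real.sqrt_mul (div_nonneg (hw0 τ) (hx0 _))]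
      congr 2
      rcases (hw0 τ).eq_or_lt with h | h
      · simp [← h]
      · have hxpos : 0 < x (τ i) := by
          rw [← hw (τ i)]
          refine lt_of_lt_of_le h ?_
          refine le_trans ?_ (Finset.single_le_sum (f := fun σ : Fin M ↪ ι =>
            w σ * ∑ l, (if σ l = τ i then (1 : ℝ) else 0)) (fun σ _ => mul_nonneg (hw0 σ)
              (Finset.sum_nonneg fun l _ => by split_ifs <;> norm_num)) (Finset.mem_univ τ))
          simp [EmbeddingLike.apply_eq_iff_eq]
        have hgood : ¬ c < p (τ i) := by
          intro hbad
          simp [hx, hbad] at hxpos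
        have := hp (τ i)
        simp only [hx, if_neg hgood]
        field_simp
    simp only [hK, Option.elim_some]
    rw [Matrix.mul_assoc, h1, Matrix.mul_assoc, ← Matrix.mul_assoc (diagonal _), h4,
      Matrix.smul_mul, Matrix.one_mul, Matrix.mul_smul, Matrix.smul_mul]
  have hKnone : frobSq (K none * X) = ε := by
    have h1 : K none * X =
        U * diagonal (fun k => ((if c < p k then √(p k) else 0 : ℝ) : ℂ)) * Vᵀ := by
      change (1 - P) * X = _
      rw [Matrix.sub_mul, Matrix.one_mul, hP, hX,
        show ∀ D D' : Matrix ι ι ℂ, U * D * Uᴴ * (U * D' * Vᵀ) = U * (D * (Uᴴ * U) * D') * Vᵀ by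
          intro D D'; simp only [Matrix.mul_assoc], hU, Matrix.mul_one, diagonal_mul_diagonal,
        ← Matrix.sub_mul, ← Matrix.mul_sub, diagonal_sub]
      congr 3
      ext k
      split_ifs <;> simp
    rw [h1, frobSq_mul_diagonal_mul hU hV, ← hε]
    refine Finset.sum_congr rfl fun k _ => ?_
    split_ifs
    · rw [Real.sq_sqrt (hp k).le, mul_one]
    · simp
  refine ⟨M, Φ, _, hΦ, IsLOCC.alice_of_fintype (fun _ => a) K hKsum
    (fun o => o.elim id B) (fun o => ?_), ?_, hMlow⟩
  · cases o
    exacts [IsLOCC.done, hB _]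
  have hterm (τ : Fin M ↪ ι) : B τ (vecDensity (K (some τ) * X)) =
      ((w τ * s : ℝ) : ℂ) • vecDensity (coeffMatrix Φ) := by
    rw [hKX, hBV, hΦEF, Matrix.smul_mul, vecDensity_smul, vecDensity_smul, smul_smul]
    congr 1
    rw [← starRingEnd_apply, ← starRingEnd_apply, Complex.conj_ofReal, Complex.conj_ofReal,
      ← Complex.ofReal_mul, ← Complex.ofReal_mul, ← Complex.ofReal_mul, Real.mul_self_sqrt
      (div_nonneg (mul_nonneg (hw0 τ) hs0.le) hM'.le), ← mul_inv, Real.mul_self_sqrt hM'.le]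
    congr 1
  -- Success yields exactly `(1 - ε) Φ`, so the error is a difference of two positive operators of
  -- trace `ε`.
  have hout : (∑ o, (o.elim id B : Matrix (Fin a × Fin b) (Fin a × Fin b) ℂ → _)
      ((K o ⊗ₖ (1 : Matrix (Fin b) (Fin b) ℂ)) * vecDensity X *
        (K o ⊗ₖ (1 : Matrix (Fin b) (Fin b) ℂ))ᴴ)) - vecDensity (coeffMatrix Φ) =
      vecDensity (K none * X) - (ε : ℂ) • vecDensity (coeffMatrix Φ) := by
    simp only [kronecker_conj_vecDensity, transpose_one, Matrix.mul_one]
    rw [Fintype.sum_option]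
    simp only [Option.elim_none, Option.elim_some, id, hterm]
    rw [← Finset.sum_smul, ← Complex.ofReal_sum, ← Finset.sum_mul, hw1, one_mul, hsε,
      Complex.ofReal_sub, sub_smul, Complex.ofReal_one, one_smul]
    abel
  rw [hout]
  refine (traceNorm_sub_le (posSemidef_vecDensity _)
    ((posSemidef_vecDensity _).smul (by exact_mod_cast hε0))).trans ?_
  rw [trace_smul, trace_vecDensity_eq_frobSq, trace_vecDensity_eq_frobSq, hKnone, hΦ1]
  simp only [Complex.ofReal_one, smul_eq_mul, mul_one, Complex.ofReal_re]
  linarith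

/-! ### Asymptotics -/

theorem traceNorm_nonneg {ι : Type*} [Fintype ι] [DecidableEq ι] (A : Matrix ι ι ℂ) :
    0 ≤ traceNorm A := by
  obtain ⟨U, hU, -, -, hf⟩ := exists_unitary_cfc (isHermitian_conjTranspose_mul_self A)
  rw [traceNorm, hf, trace_mul_comm, ← Matrix.mul_assoc, hU, Matrix.one_mul, trace_diagonal,
    Complex.re_sum]
  exact Finset.sum_nonneg fun i _ => by simp

section Rates

variable {dA dB : ℕ → ℕ} {ψ : ∀ n, EuclideanSpace ℂ (Fin (dA n) × Fin (dB n))}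

/-- The weight of the eigenvalues of the reduced states above `e^{na}`. -/
noncomputable def upperWeight (ψ : ∀ n, EuclideanSpace ℂ (Fin (dA n) × Fin (dB n))) (a : ℝ) (n : ℕ) : ℝ :=
  (partialTraceB (pureDensity (ψ n)) * posProj (partialTraceB (pureDensity (ψ n)) -
    Real.exp (n * a) • (1 : Matrix (Fin (dA n)) (Fin (dA n)) ℂ))).trace.re

theorem Achievable.limsup_upperWeight_le (hψ : ∀ n, ‖ψ n‖ = 1) {R a : ℝ} (hR : Achievable ψ R)
    (ha : -R < a) : limsup (fun n => (upperWeight ψ a n : EReal)) atTop ≤ 0 := by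
  obtain ⟨M, Φ, hΦ, ⟨L, hL, hlim⟩, hM⟩ := hR
  -- Half the gap is spent on the liminf, so `M > e^{n(R - g)}`; the other half gives `e^{na} M >
  -- e^{ng}`, that is `q = e^{-ng}`.
  set g : ℝ := (a + R) / 2 with hg
  have hg0 : 0 < g := by linarith
  have hq : Tendsto (fun n : ℕ => Real.exp (-(n * g))) atTop (𝓝 0) :=
    Real.tendsto_exp_neg_atTop_nhds_zero.comp
      (tendsto_natCast_atTop_atTop.atTop_mul_const hg0)
  have hbound : Tendsto (fun n : ℕ => traceNorm (L n (pureDensity (ψ n)) - pureDensity (Φ n)) +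
      2 * √(Real.exp (-(n * g))) + Real.exp (-(n * g))) atTop (𝓝 0) := by
    simpa using (hlim.add ((hq.sqrt).const_mul 2)).add hq
  have hMe : ∀ᶠ n : ℕ in atTop, R - g < 1 / (n : ℝ) * Real.log (M n) := by
    have hlt : ((R - g : ℝ) : EReal) < R := by exact_mod_cast sub_lt_self R hg0
    filter_upwards [eventually_lt_of_lt_liminf (hlt.trans_le hM)] with n hn
    exact_mod_cast hn
  have hle : ∀ᶠ n : ℕ in atTop, (upperWeight ψ a n : EReal) ≤
      ((traceNorm (L n (pureDensity (ψ n)) - pureDensity (Φ n)) +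
        2 * √(Real.exp (-(n * g))) + Real.exp (-(n * g)) : ℝ) : EReal) := by
    filter_upwards [hMe, eventually_gt_atTop 0] with n hn hn0
    have hn0' : (0 : ℝ) < n := by exact_mod_cast hn0
    have hMpos : (0 : ℝ) < M n := by exact_mod_cast (hΦ n).1
    refine EReal.coe_le_coe_iff.2 ((hL n).trace_mul_posProj_le (hψ n) (hΦ n) (Real.exp_pos _)
      (Real.exp_pos _) ?_)
    have h1 : n * (R - g) < Real.log (M n) := by
      rw [one_div, inv_mul_eq_div, lt_div_iff₀ hn0'] at hn
      linarith
    have h2 : Real.exp (n * (R - g)) < M n := (Real.lt_log_iff_exp_lt hMpos).1 h1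
    rw [div_le_iff₀ (mul_pos (Real.exp_pos _) hMpos), ← mul_assoc, ← Real.exp_add]
    calc (1 : ℝ) = Real.exp (-(n * g) + n * a) * Real.exp (n * (R - g)) := by
          rw [← Real.exp_add, ← Real.exp_zero]
          congr 1
          rw [hg]
          ring
      _ ≤ _ := by gcongr
  refine (limsup_le_limsup hle).trans ?_
  exact ((continuous_coe_real_ereal.tendsto 0).comp hbound).limsup_eq.le

theorem achievable_of_limsup_upperWeight_le (hψ : ∀ n, ‖ψ n‖ = 1) {R a : ℝ}
    (h : limsup (fun n => (upperWeight ψ a n : EReal)) atTop ≤ 0) (hR : R < -a) :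
    Achievable ψ R := by
  have hsmall (η : ℝ) (hη : 0 < η) : ∀ᶠ n in atTop, upperWeight ψ a n < η := by
    filter_upwards [eventually_lt_of_limsup_lt
      (h.trans_lt (by exact_mod_cast hη : (0 : EReal) < (η : EReal)))] with n hn
    exact_mod_cast hn
  choose M Φ L hΦ hL hLΦ hM using fun n => exists_isLOCC_concentration (hψ n)
    (Real.exp_pos (n * a)) (ε := upperWeight ψ a n) rfl
  refine ⟨M, Φ, hΦ, ⟨L, hL, ?_⟩, ?_⟩
  · refine tendsto_order.2 ⟨fun η hη => Eventually.of_forall fun n =>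
      hη.trans_le (traceNorm_nonneg _), fun η hη => ?_⟩
    filter_upwards [hsmall (η / 2) (by linarith)] with n hn
    linarith [hLΦ n]
  · refine le_liminf_of_le (h := ?_)
    -- With weight below `1/2` the rank bound gives `M ≥ e^{-na} / 4`; the gap `-a - R > 0` absorbs
    -- `log 4` for large `n`.
    filter_upwards [hsmall (1 / 2) (by norm_num), eventually_gt_atTop 0,
      (tendsto_natCast_atTop_atTop (R := ℝ)).eventually_ge_atTop (Real.log 4 / (-a - R))]
      with n hn hn0 hnl
    have hn0' : (0 : ℝ) < n := by exact_mod_cast hn0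
    rw [EReal.coe_le_coe_iff, one_div, inv_mul_eq_div, le_div_iff₀ hn0']
    rw [div_le_iff₀ (by linarith)] at hnl
    have hlow : Real.exp (-(n * a)) / 4 ≤ M n := by
      refine le_trans ?_ (hM n)
      rw [Real.exp_neg, div_le_div_iff₀ (by norm_num) (by positivity)]
      have := Real.exp_pos (n * a)
      field_simp
      linarith
    have hlog := Real.log_le_log (by positivity) hlow
    rw [Real.log_div (Real.exp_pos _).ne' (by norm_num), Real.log_exp] at hlog
    linarith

/-- Each one-shot bound loses an arbitrarily small amount of rate. Comparing only with real numbers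
strictly beyond the bound absorbs this loss and covers infinite rates too. -/
theorem concentrationRate_eq (hψ : ∀ n, ‖ψ n‖ = 1) :
    concentrationRate ψ =
      infSpectralEntropyRate (fun n => partialTraceB (pureDensity (ψ n))) := by
  set D := supSpectralDivergenceRate 0 (fun n => partialTraceB (pureDensity (ψ n)))
    (fun _ => 1) with hD
  change concentrationRate ψ = -D
  have hmem {a : ℝ} (ha : limsup (fun n => (upperWeight ψ a n : EReal)) atTop ≤ 0) : D ≤ a :=
    sInf_le ⟨a, ha, rfl⟩
  apply le_antisymm
  · refine sSup_le ?_
    rintro _ ⟨R, hR, rfl⟩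
    refine EReal.le_neg_of_le_neg (EReal.le_of_forall_lt_iff_le.1 fun z hz => ?_)
    refine hmem (hR.limsup_upperWeight_le hψ ?_)
    exact_mod_cast (show -(R : EReal) < z from hz)
  · refine EReal.ge_of_forall_gt_iff_ge.1 fun z hz => ?_
    obtain ⟨_, ⟨a, ha, rfl⟩, haz⟩ := sInf_lt_iff.1 (EReal.lt_neg_comm.1 hz)
    have haz' : a < -z := by exact_mod_cast (show (a : EReal) < -(z : EReal) from haz)
    exact le_sSup ⟨z, achievable_of_limsup_upperWeight_le hψ ha (by linarith), rfl⟩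

end Rates

end EntConc

theorem proposition1 (dA dB : ℕ → ℕ)
    (ψ : ∀ n, EuclideanSpace ℂ (Fin (dA n) × Fin (dB n))) (hψ : ∀ n, ‖ψ n‖ = 1) :
    EntConc.concentrationRate ψ =
      EntConc.infSpectralEntropyRate
        (fun n => EntConc.partialTraceB (EntConc.pureDensity (ψ n))) :=
  EntConc.concentrationRate_eq hψ
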